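/- Let $\mathbb{K}$ be a field, $\Gamma$ a totally ordered abelian group, $\nu_0:\mathbb{K}\to\Gamma\cup\{\infty\}$ a valuation, and $\nu:\mathbb{K}[x]\to\Gamma\cup\{\infty\}$ a valuation extending $\nu_0$ (a valuation satisfies $\nu(fg)=\nu(f)+\nu(g)$, $\nu(f+g)\ge\min\{\nu(f),\nu(g)\}$, $\nu(1)=0$, $\nu(0)=\infty$; it may take the value $\infty$ on nonzero elements). Call a valuation $\mu$ on $\mathbb{K}[x]$ *Krull* if $\mu(f)=\infty$ only for $f=0$; in that case it extends to $\mathbb{K}(x)$ by $\mu(f/g)=\mu(f)-\mu(g)$, and $\mathbb{K}(x)\mu$ denotes its residue field. Write $\mathbb{K}\nu_0$ for the residue field of $\nu_0$, and $\mu(\mathbb{K}[x])$, $\nu_0\mathbb{K}$ for the value groups, i.e. the subgroups of $\Gamma$ generated by the finite values. A valuation $\mu$ on $\mathbb{K}[x]$ extending $\nu_0$ is *value-transcendental* if it is not Krull or $\mu(\mathbb{K}[x])/\nu_0\mathbb{K}$ is not a torsion group; it is *residue-transcendental* if it is Krull and the field extension $\mathbb{K}(x)\mu\mid\mathbb{K}\nu_0$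 is transcendental; it is *valuation-algebraic* if it is neither value-transcendental nor residue-transcendental. For a non-constant polynomial $q\in\mathbb{K}[x]$, every $f\in\mathbb{K}[x]$ has a unique $q$-expansion $f=f_0+f_1q+\dots+f_sq^s$ with $\deg f_i<\deg q$ for all $i$; the *truncation* of $\nu$ at $q$ is the map $\nu_q(f)=\min_{0\le i\le s}\nu(f_iq^i)$. Suppose that $\nu$ is valuation-algebraic and that $q\in\mathbb{K}[x]$ is a non-constant polynomial such that $\nu_q$ is a valuation on $\mathbb{K}[x]$. Then $\nu_q$ is a valuation extending $\nu_0$ which is residue-transcendental. -/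

import Mathlib

open Polynomial

namespace PolyVal

section ValueGroup

variable {R : Type*} [CommRing R]
variable {Γ : Type*} [AddCommGroup Γ] [LinearOrder Γ] [IsOrderedAddMonoid Γ]

/-- A valuation is Krull if its support `{a | v a = ∞}` is `{0}`. -/
def IsKrull (v : AddValuation R (WithTop Γ)) : Prop :=
  v.supp = ⊥

/-- The value group: the subgroup of `Γ` generated by the finite values of `v`. -/
def valueGroup (v : AddValuation R (WithTop Γ)) : AddSubgroup Γ :=
  AddSubgroup.closure {γ : Γ | ∃ a : R, v a = (γ : WithTop Γ)}

end ValueGroup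

section Truncation

variable {K : Type*} [Field K]

/-- The coefficients `f₀, f₁, …` of the `q`-expansion `f = f₀ + f₁ q + f₂ q² + …`, by iterated
division with remainder. They vanish beyond the index `f.natDegree` if `q` is non-constant;
see `qCoeff_unique` for the characterization. -/
noncomputable def qCoeff (q : K[X]) : K[X] → ℕ → K[X]
  | f, 0 => f % q
  | f, i + 1 => qCoeff q (f / q) i

theorem degree_qCoeff_lt (q : K[X]) (hq : 0 < q.natDegree) (f : K[X]) (i : ℕ) :
    (qCoeff q f i).degree < q.degree := by
  have hq0 : q ≠ 0 := by rintro rfl; simp at hq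
  induction i generalizing f with
  | zero => exact EuclideanDomain.mod_lt f hq0
  | succ i ih => exact ih (f / q)

theorem sum_qCoeff_aux (q : K[X]) (hq : 0 < q.natDegree) (n : ℕ) (f : K[X])
    (hf : f.natDegree ≤ n) :
    f = ∑ i ∈ Finset.range (n + 1), qCoeff q f i * q ^ i := by
  induction n generalizing f with
  | zero =>
    have hlt : f.degree < q.degree := Polynomial.degree_lt_degree (by omega)
    have hq0 : q ≠ 0 := by rintro rfl; simp at hq
    simp [qCoeff, (Polynomial.mod_eq_self_iff hq0).2 hlt]
  | succ n ih =>
    have hd : (f / q).natDegree ≤ n := by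
      rcases eq_or_ne f 0 with rfl | hf0
      · simp
      by_cases hz : f / q = 0
      · simp [hz]
      have := Polynomial.natDegree_lt_natDegree hz
        (Polynomial.degree_div_lt hf0 (Polynomial.natDegree_pos_iff_degree_pos.1 hq))
      omega
    rw [Finset.sum_range_succ']
    have h := ih (f / q) hd
    calc f = q * (f / q) + f % q := (EuclideanDomain.div_add_mod f q).symm
      _ = q * (∑ i ∈ Finset.range (n + 1), qCoeff q (f / q) i * q ^ i) + f % q := by rw [← h]
      _ = _ := by
        rw [Finset.mul_sum]
        simp only [qCoeff, pow_zero, mul_one]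
        congr 1
        exact Finset.sum_congr rfl fun i _ => by ring

/-- The `qCoeff q f i` are the coefficients of a `q`-expansion of `f`. -/
theorem sum_qCoeff (q : K[X]) (hq : 0 < q.natDegree) (f : K[X]) :
    f = ∑ i ∈ Finset.range (f.natDegree + 1), qCoeff q f i * q ^ i :=
  sum_qCoeff_aux q hq f.natDegree f le_rfl

/-- Any `q`-expansion of `f` has the coefficients `qCoeff q f i`. -/
theorem qCoeff_unique (q : K[X]) (hq : 0 < q.natDegree) (n : ℕ) (f : K[X]) (c : ℕ → K[X])
    (hc : ∀ i, (c i).degree < q.degree) (hf : f = ∑ i ∈ Finset.range n, c i * q ^ i) (i : ℕ) :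
    qCoeff q f i = if i < n then c i else 0 := by
  have hq0 : q ≠ 0 := by rintro rfl; simp at hq
  induction n generalizing f c i with
  | zero =>
    have h0 : f = 0 := by simpa using hf
    subst h0
    have : ∀ i, qCoeff q 0 i = 0 := by
      intro i
      induction i with
      | zero => simp [qCoeff]
      | succ i ih => simpa [qCoeff] using ih
    simpa using this i
  | succ n ih =>
    have hf' : f = c 0 + q * ∑ i ∈ Finset.range n, c (i + 1) * q ^ i := by
      rw [hf, Finset.sum_range_succ', Finset.mul_sum, add_comm]
      simp only [pow_zero, mul_one]
      congr 1
      exact Finset.sum_congr rfl fun i _ => by ring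
    have hm : f % q = c 0 := by
      rw [hf', Polynomial.add_mod, (Polynomial.mod_eq_self_iff hq0).2 (hc 0)]
      simp
    have hd : f / q = ∑ i ∈ Finset.range n, c (i + 1) * q ^ i := by
      have h1 := EuclideanDomain.div_add_mod f q
      rw [hm] at h1
      have h2 : q * (f / q) = q * ∑ i ∈ Finset.range n, c (i + 1) * q ^ i := by
        linear_combination h1 + hf'
      exact mul_left_cancel₀ hq0 h2
    cases i with
    | zero => simpa [qCoeff] using hm
    | succ i =>
      have := ih (f / q) (fun i => c (i + 1)) (fun i => hc (i + 1)) hd i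
      simpa [qCoeff] using this

variable {Γ : Type*} [AddCommGroup Γ] [LinearOrder Γ] [IsOrderedAddMonoid Γ]

/-- The truncation `f ↦ min_i ν(f_i q^i)` of `ν` at `q`, over the coefficients `f_i` of the
`q`-expansion of `f` (the vanishing coefficients contribute the value `∞`). It is only a map, in
general not a valuation. -/
noncomputable def truncation (ν : AddValuation K[X] (WithTop Γ)) (q f : K[X]) : WithTop Γ :=
  (Finset.range (f.natDegree + 1)).inf fun i => ν (qCoeff q f i * q ^ i)

end Truncation

section Transcendental

variable {K : Type*} [Field K]
variable {Γ : Type*} [AddCommGroup Γ] [LinearOrder Γ] [IsOrderedAddMonoid Γ]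

/-- `ν` on `K[x]` extends `ν₀` on `K`. -/
def Extends (ν₀ : AddValuation K (WithTop Γ)) (ν : AddValuation K[X] (WithTop Γ)) : Prop :=
  ∀ a : K, ν (C a) = ν₀ a

theorem IsKrull.nonZeroDivisors_le {ν : AddValuation K[X] (WithTop Γ)} (h : IsKrull ν) :
    nonZeroDivisors K[X] ≤ (AddValuation.toValuation ν).supp.primeCompl := by
  intro f hf hmem
  have h1 : f ∈ ν.supp := hmem
  rw [h, Ideal.mem_bot] at h1
  exact nonZeroDivisors.ne_zero hf h1

/-- The extension of a Krull valuation `ν` from `K[x]` to `K(x)`, `ν(f/g) = ν(f) - ν(g)`, in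
Mathlib's multiplicative convention (the order is reversed). -/
noncomputable def toRatFunc (ν : AddValuation K[X] (WithTop Γ)) (h : IsKrull ν) :
    Valuation (RatFunc K) (Multiplicative (WithTop Γ)ᵒᵈ) :=
  (AddValuation.toValuation ν).extendToLocalization h.nonZeroDivisors_le (RatFunc K)

theorem Extends.hasExtension {ν₀ : AddValuation K (WithTop Γ)}
    {ν : AddValuation K[X] (WithTop Γ)} (hext : Extends ν₀ ν) (h : IsKrull ν) :
    (AddValuation.toValuation ν₀).HasExtension (toRatFunc ν h) where
  val_isEquiv_comap := by
    apply Valuation.IsEquiv.of_eq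
    ext a
    rw [Valuation.comap_apply, IsScalarTower.algebraMap_apply K K[X] (RatFunc K), toRatFunc,
      Valuation.extendToLocalization_apply_map_apply]
    exact congrArg (fun z : WithTop Γ => Multiplicative.ofAdd (OrderDual.toDual z)) (hext a).symm

/-- The residue field `Kν₀`. -/
abbrev ResidueBase (ν₀ : AddValuation K (WithTop Γ)) : Type _ :=
  IsLocalRing.ResidueField (AddValuation.toValuation ν₀).valuationSubring

/-- The residue field `K(x)ν` of a Krull valuation on `K[x]`. -/
abbrev ResidueRatFunc (ν : AddValuation K[X] (WithTop Γ)) (h : IsKrull ν) : Type _ :=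
  IsLocalRing.ResidueField (toRatFunc ν h).valuationSubring

/-- `ν` extends `ν₀`, and is not Krull or has a value group that is not torsion over that
of `ν₀`. -/
def IsValueTranscendental (ν₀ : AddValuation K (WithTop Γ))
    (ν : AddValuation K[X] (WithTop Γ)) : Prop :=
  Extends ν₀ ν ∧
    (¬ IsKrull ν ∨
      ¬ IsAddTorsion (valueGroup ν ⧸ (valueGroup ν₀).addSubgroupOf (valueGroup ν)))

/-- `ν` extends `ν₀`, is Krull, and `K(x)ν ∣ Kν₀` is a transcendental field extension. -/
def IsResidueTranscendental (ν₀ : AddValuation K (WithTop Γ))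
    (ν : AddValuation K[X] (WithTop Γ)) : Prop :=
  ∃ (hext : Extends ν₀ ν) (h : IsKrull ν),
    haveI := hext.hasExtension h
    Algebra.Transcendental (ResidueBase ν₀) (ResidueRatFunc ν h)

def IsValuationTranscendental (ν₀ : AddValuation K (WithTop Γ))
    (ν : AddValuation K[X] (WithTop Γ)) : Prop :=
  IsValueTranscendental ν₀ ν ∨ IsResidueTranscendental ν₀ ν

def IsValuationAlgebraic (ν₀ : AddValuation K (WithTop Γ))
    (ν : AddValuation K[X] (WithTop Γ)) : Prop :=
  Extends ν₀ ν ∧ ¬ IsValuationTranscendental ν₀ ν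

end Transcendental

end PolyVal

/-!
If a positive multiple of `ν(q)` is a value of `ν₀`, then some `g = a qᵉ` with `a ∈ K` and `e > 0`
has value `0`. The `q`-expansion of `P(g)`, for `P = ∑ Pᵢ xⁱ` in `K[x]`, is `∑ (Pᵢ aⁱ) q^{ei}`, so
`ν_q(P(g)) = min ν₀(Pᵢ)`: on `K[g]` the truncation is the Gauss valuation, and the residue of `g` is
transcendental over `Kν₀`.

Since `ν_q` is a valuation and `ν(q)` is finite, `ν_q` is Krull: a nonzero polynomial of value `∞`
has a nonzero coefficient `r` in its `q`-expansion with `ν_q(r) = ν(r) = ∞`. Then the multiple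
`q - (q mod r)` of `r` has value `∞` as well, although its `q`-expansion contains the term `q`.
-/

namespace PolyVal

section ResidueTranscendence

open IsLocalRing

variable {K L Γ₀ Γ₁ : Type*} [Field K] [Field L] [Algebra K L]
  [LinearOrderedCommGroupWithZero Γ₀] [LinearOrderedCommGroupWithZero Γ₁]

theorem transcendental_residue_of_forall_coeff_le (vK : Valuation K Γ₀) {vL : Valuation L Γ₁}
    [vK.HasExtension vL] {y : vL.valuationSubring}
    (hy : ∀ (P : K[X]) (i : ℕ), vL (algebraMap K L (P.coeff i)) ≤ vL (aeval (y : L) P)) :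
    Transcendental (ResidueField vK.valuationSubring) (residue vL.valuationSubring y) := by
  refine transcendental_iff.2 fun p hp => ?_
  obtain ⟨P, rfl⟩ := map_surjective _ residue_surjective p
  have hres : residue vL.valuationSubring (aeval y P) = 0 :=
    (map_aeval_eq_aeval_map (T := ResidueField vK.valuationSubring)
      (ψ := residue vL.valuationSubring) rfl P y).trans hp
  have hlt : vL (aeval y P : vL.valuationSubring) < 1 :=
    (Valuation.mem_maximalIdeal_iff _ _).1 ((residue_eq_zero_iff _).1 hres)
  have hcoe : ((aeval y P : vL.valuationSubring) : L) =
      aeval (y : L) (P.map vK.valuationSubring.subtype) :=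
    map_aeval_eq_aeval_map (T := K) (ψ := vL.valuationSubring.subtype) rfl P y
  rw [hcoe] at hlt
  ext i
  have hle := hy (P.map vK.valuationSubring.subtype) i
  rw [coeff_map] at hle
  rw [coeff_map, coeff_zero, residue_eq_zero_iff, Valuation.mem_maximalIdeal_iff,
    ← Valuation.HasExtension.val_map_lt_one_iff vK vL]
  exact hle.trans_lt hlt

end ResidueTranscendence

section ValueGroup

variable {K : Type*} [Field K] {R : Type*} [CommRing R]
variable {Γ : Type*} [AddCommGroup Γ] [LinearOrder Γ] [IsOrderedAddMonoid Γ]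

theorem IsKrull.ne_top {v : AddValuation R (WithTop Γ)} (hv : IsKrull v) {f : R} (hf : f ≠ 0) :
    v f ≠ ⊤ := fun htop =>
  hf <| (Submodule.eq_bot_iff _).1 hv f ((AddValuation.mem_supp_iff v f).2 htop)

theorem mem_valueGroup_iff {v : AddValuation K (WithTop Γ)} {γ : Γ} :
    γ ∈ valueGroup v ↔ ∃ a : K, v a = γ := by
  refine ⟨fun hγ => ?_, fun ha => AddSubgroup.subset_closure ha⟩
  induction hγ using AddSubgroup.closure_induction with
  | mem _ ha => exact ha
  | zero => exact ⟨1, v.map_one⟩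
  | add _ _ _ _ hγ hδ =>
    obtain ⟨a, ha⟩ := hγ
    obtain ⟨b, hb⟩ := hδ
    exact ⟨a * b, by rw [v.map_mul, ha, hb, WithTop.coe_add]⟩
  | neg _ _ hγ =>
    obtain ⟨a, ha⟩ := hγ
    exact ⟨a⁻¹, by rw [v.map_inv, ha, WithTop.LinearOrderedAddCommGroup.coe_neg]⟩

theorem exists_nsmul_mem_valueGroup {S : Type*} [CommRing S] {v₀ : AddValuation S (WithTop Γ)}
    {v : AddValuation R (WithTop Γ)}
    (htor : IsAddTorsion (valueGroup v ⧸ (valueGroup v₀).addSubgroupOf (valueGroup v)))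
    {f : R} (hf : v f ≠ ⊤) :
    ∃ e : ℕ, 0 < e ∧ ∃ γ ∈ valueGroup v₀, e • v f = γ := by
  obtain ⟨γ, hγ⟩ := WithTop.ne_top_iff_exists.1 hf
  let g : valueGroup v := ⟨γ, AddSubgroup.subset_closure ⟨f, hγ.symm⟩⟩
  obtain ⟨e, he, heg⟩ := isOfFinAddOrder_iff_nsmul_eq_zero.1
    (htor (g : valueGroup v ⧸ (valueGroup v₀).addSubgroupOf (valueGroup v)))
  rw [← QuotientAddGroup.mk_nsmul, QuotientAddGroup.eq_zero_iff,
    AddSubgroup.mem_addSubgroupOf] at heg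
  exact ⟨e, he, e • γ, heg, by rw [← hγ, WithTop.coe_nsmul]⟩

end ValueGroup

section Truncation

variable {K : Type*} [Field K] {q : K[X]}

theorem degree_C_lt_of_natDegree_pos (hq : 0 < q.natDegree) (a : K) :
    (C a).degree < q.degree :=
  degree_C_le.trans_lt (natDegree_pos_iff_degree_pos.1 hq)

theorem qCoeff_eq_zero_of_natDegree_lt (hq : 0 < q.natDegree) {f : K[X]} {i : ℕ}
    (hi : f.natDegree < i) : qCoeff q f i = 0 := by
  rw [qCoeff_unique q hq _ f _ (degree_qCoeff_lt q hq f) (sum_qCoeff q hq f), if_neg (by omega)]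

theorem qCoeff_mul_pow (hq : 0 < q.natDegree) {f : K[X]} (hf : f.degree < q.degree) (n i : ℕ) :
    qCoeff q (f * q ^ n) i = if i = n then f else 0 := by
  rw [qCoeff_unique q hq (n + 1) (f * q ^ n) (fun j => if j = n then f else 0)]
  · grind
  · intro j
    split_ifs
    exacts [hf, degree_zero.trans_lt (bot_lt_of_lt hf)]
  · simp

theorem qCoeff_comp (hq : 0 < q.natDegree) (P : K[X]) (i : ℕ) :
    qCoeff q (P.comp q) i = C (P.coeff i) := by
  rw [qCoeff_unique q hq (P.natDegree + 1) (P.comp q) (fun j => C (P.coeff j))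
    (fun j => degree_C_lt_of_natDegree_pos hq _)
    (by rw [comp, eval₂_eq_sum_range])]
  split_ifs with hi
  · rfl
  · rw [coeff_eq_zero_of_natDegree_lt (by omega), C_0]

theorem qCoeff_add_self_one (hq : 0 < q.natDegree) {r : K[X]} (hr : r.degree < q.degree) :
    qCoeff q (r + q) 1 = 1 := by
  rw [qCoeff_unique q hq 2 (r + q) (fun j => if j = 0 then r else 1)]
  · simp
  · intro j
    split_ifs
    exacts [hr, degree_C_lt_of_natDegree_pos hq 1]
  · simp [Finset.sum_range_succ]

theorem qCoeff_comp_C_mul_pow (hq : 0 < q.natDegree) {e : ℕ} (he : 0 < e) (b : K) (P : K[X])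
    (i : ℕ) : qCoeff q (P.comp (C b * q ^ e)) (e * i) = C (P.coeff i * b ^ i) := by
  have hcomp : P.comp (C b * q ^ e) = (expand K e (P.comp (C b * X))).comp q := by
    simp only [expand_eq_comp_X_pow, comp_assoc, mul_comp, C_comp, X_comp, pow_comp]
  rw [hcomp, qCoeff_comp hq, coeff_expand_mul' he, comp_C_mul_X_coeff]

variable {Γ : Type*} [AddCommGroup Γ] [LinearOrder Γ] [IsOrderedAddMonoid Γ]
  {ν νq : AddValuation K[X] (WithTop Γ)}

theorem le_truncation_iff (hq : 0 < q.natDegree) {f : K[X]} {γ : WithTop Γ} :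
    γ ≤ truncation ν q f ↔ ∀ i, γ ≤ ν (qCoeff q f i * q ^ i) := by
  refine Finset.le_inf_iff.trans ⟨fun h i => ?_, fun h i _ => h i⟩
  by_cases hi : i < f.natDegree + 1
  · exact h i (Finset.mem_range.2 hi)
  · simp [qCoeff_eq_zero_of_natDegree_lt hq (show f.natDegree < i by omega)]

theorem truncation_le (hq : 0 < q.natDegree) (f : K[X]) (i : ℕ) :
    truncation ν q f ≤ ν (qCoeff q f i * q ^ i) :=
  (le_truncation_iff hq).1 le_rfl i

theorem truncation_mul_pow (hq : 0 < q.natDegree) {f : K[X]} (hf : f.degree < q.degree) (n : ℕ) :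
    truncation ν q (f * q ^ n) = ν (f * q ^ n) := by
  refine le_antisymm ?_ ((le_truncation_iff hq).2 fun i => ?_)
  · simpa only [qCoeff_mul_pow hq hf, if_true] using truncation_le (ν := ν) hq (f * q ^ n) n
  · rw [qCoeff_mul_pow hq hf]
    split_ifs with hi
    · rw [hi]
    · simp

theorem truncation_eq_of_degree_lt (hq : 0 < q.natDegree) {f : K[X]} (hf : f.degree < q.degree) :
    truncation ν q f = ν f := by
  simpa using truncation_mul_pow (ν := ν) hq hf 0

theorem truncation_comp_C_mul_pow_le (hq : 0 < q.natDegree) {e : ℕ} (he : 0 < e) (b : K)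
    (P : K[X]) (i : ℕ) :
    truncation ν q (P.comp (C b * q ^ e)) ≤ ν (C (P.coeff i) * (C b * q ^ e) ^ i) := by
  have h := truncation_le (ν := ν) hq (P.comp (C b * q ^ e)) (e * i)
  rwa [qCoeff_comp_C_mul_pow hq he, C_mul, C_pow, pow_mul, mul_assoc, ← mul_pow] at h

theorem Extends.of_forall_eq_truncation {ν₀ : AddValuation K (WithTop Γ)} (hext : Extends ν₀ ν)
    (hq : 0 < q.natDegree) (hνq : ∀ f, νq f = truncation ν q f) : Extends ν₀ νq := fun a => by
  rw [hνq, truncation_eq_of_degree_lt hq (degree_C_lt_of_natDegree_pos hq a), hext]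

theorem exists_degree_lt_eq_top_of_truncation_eq_top (hq : 0 < q.natDegree) (hqtop : ν q ≠ ⊤)
    {f : K[X]} (hf : f ≠ 0) (htop : truncation ν q f = ⊤) :
    ∃ r : K[X], r ≠ 0 ∧ r.degree < q.degree ∧ ν r = ⊤ := by
  obtain ⟨i, hi⟩ : ∃ i, qCoeff q f i ≠ 0 := by
    by_contra! hzero
    exact hf (by rw [sum_qCoeff q hq f]; simp [hzero])
  refine ⟨qCoeff q f i, hi, degree_qCoeff_lt q hq f i, ?_⟩
  have hterm : ν (qCoeff q f i * q ^ i) = ⊤ := top_le_iff.1 (htop ▸ truncation_le hq f i)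
  obtain ⟨γ, hγ⟩ := WithTop.ne_top_iff_exists.1 hqtop
  rw [ν.map_mul, ν.map_pow, ← hγ, ← WithTop.coe_nsmul, WithTop.add_eq_top] at hterm
  exact hterm.resolve_right WithTop.coe_ne_top

theorem isKrull_of_forall_eq_truncation (hq : 0 < q.natDegree) (hqtop : ν q ≠ ⊤)
    (hνq : ∀ f, νq f = truncation ν q f) : IsKrull νq := by
  by_contra hnot
  obtain ⟨f, hf, hf0⟩ := Submodule.exists_mem_ne_zero_of_ne_bot hnot
  obtain ⟨r, hr0, hrq, hr⟩ := exists_degree_lt_eq_top_of_truncation_eq_top hq hqtop hf0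
    (hνq f ▸ (AddValuation.mem_supp_iff νq f).1 hf)
  have hmul : -(q % r) + q = r * (q / r) := by
    linear_combination -EuclideanDomain.div_add_mod q r
  have hmod : (-(q % r)).degree < q.degree := by
    rw [degree_neg]
    exact (EuclideanDomain.mod_lt q hr0).trans hrq
  have htop : νq (-(q % r) + q) = ⊤ := by
    rw [hmul, νq.map_mul, hνq r, truncation_eq_of_degree_lt hq hrq, hr, WithTop.top_add]
  have hle := truncation_le (ν := ν) hq (-(q % r) + q) 1
  rw [← hνq, htop, qCoeff_add_self_one hq hmod, one_mul, pow_one] at hle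
  exact hqtop (top_le_iff.1 hle)

end Truncation

section ResidueRatFunc

variable {K : Type*} [Field K]
variable {Γ : Type*} [AddCommGroup Γ] [LinearOrder Γ] [IsOrderedAddMonoid Γ]
  {ν₀ : AddValuation K (WithTop Γ)} {ν : AddValuation K[X] (WithTop Γ)}

theorem toRatFunc_algebraMap (hν : IsKrull ν) (f : K[X]) :
    toRatFunc ν hν (algebraMap K[X] (RatFunc K) f) = AddValuation.toValuation ν f :=
  Valuation.extendToLocalization_apply_map_apply ..

theorem transcendental_residueRatFunc_of_comp_le (hext : Extends ν₀ ν) (hν : IsKrull ν) {g : K[X]}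
    (hg : 0 ≤ ν g) (hle : ∀ (P : K[X]) (i : ℕ), ν (P.comp g) ≤ ν₀ (P.coeff i)) :
    haveI := hext.hasExtension hν
    Algebra.Transcendental (ResidueBase ν₀) (ResidueRatFunc ν hν) := by
  have := hext.hasExtension hν
  let y : (toRatFunc ν hν).valuationSubring := ⟨algebraMap K[X] (RatFunc K) g, by
    rw [Valuation.mem_valuationSubring_iff, toRatFunc_algebraMap]
    exact hg⟩
  refine ⟨_, transcendental_residue_of_forall_coeff_le _ (y := y) fun P i => ?_⟩
  rw [aeval_algebraMap_apply, ← comp_eq_aeval, IsScalarTower.algebraMap_apply K K[X] (RatFunc K),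
    toRatFunc_algebraMap, toRatFunc_algebraMap]
  exact (hle P i).trans_eq (hext _).symm

end ResidueRatFunc

section ValuationAlgebraic

variable {K : Type*} [Field K]
variable {Γ : Type*} [AddCommGroup Γ] [LinearOrder Γ] [IsOrderedAddMonoid Γ]
  {ν₀ : AddValuation K (WithTop Γ)} {ν : AddValuation K[X] (WithTop Γ)}

theorem Extends.exists_C_mul_pow_eq_zero (hext : Extends ν₀ ν) {f : K[X]} {e : ℕ} {γ : Γ}
    (hγ : γ ∈ valueGroup ν₀) (hfγ : e • ν f = γ) : ∃ a : K, ν (C a * f ^ e) = 0 := by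
  obtain ⟨a, ha⟩ := mem_valueGroup_iff.1 (neg_mem hγ)
  refine ⟨a, ?_⟩
  rw [ν.map_mul, ν.map_pow, hext, hfγ, ha, ← WithTop.coe_add, neg_add_cancel, WithTop.coe_zero]

theorem IsValuationAlgebraic.isKrull (hν : IsValuationAlgebraic ν₀ ν) : IsKrull ν := by
  by_contra hnot
  exact hν.2 (Or.inl ⟨hν.1, Or.inl hnot⟩)

theorem IsValuationAlgebraic.isAddTorsion (hν : IsValuationAlgebraic ν₀ ν) :
    IsAddTorsion (valueGroup ν ⧸ (valueGroup ν₀).addSubgroupOf (valueGroup ν)) := by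
  by_contra hnot
  exact hν.2 (Or.inl ⟨hν.1, Or.inr hnot⟩)

theorem IsValuationAlgebraic.exists_nsmul_mem_valueGroup (hν : IsValuationAlgebraic ν₀ ν)
    {f : K[X]} (hf : f ≠ 0) : ∃ e : ℕ, 0 < e ∧ ∃ γ ∈ valueGroup ν₀, e • ν f = γ :=
  PolyVal.exists_nsmul_mem_valueGroup hν.isAddTorsion (hν.isKrull.ne_top hf)

end ValuationAlgebraic

end PolyVal

theorem mainTheorem10_general {K : Type*} [Field K]
    {Γ : Type*} [AddCommGroup Γ] [LinearOrder Γ] [IsOrderedAddMonoid Γ]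
    {ν₀ : AddValuation K (WithTop Γ)} {ν : AddValuation K[X] (WithTop Γ)}
    (hext : PolyVal.Extends ν₀ ν) {q : K[X]} (hq : 0 < q.natDegree)
    {e : ℕ} (he : 0 < e) {γ : Γ} (hγ : γ ∈ PolyVal.valueGroup ν₀) (hqγ : e • ν q = γ)
    {νq : AddValuation K[X] (WithTop Γ)} (hνq : ∀ f : K[X], νq f = PolyVal.truncation ν q f) :
    PolyVal.IsResidueTranscendental ν₀ νq := by
  have hqtop : ν q ≠ ⊤ := by
    intro htop
    obtain ⟨n, rfl⟩ := Nat.exists_eq_add_one.2 he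
    rw [htop, succ_nsmul, WithTop.add_top] at hqγ
    exact WithTop.top_ne_coe hqγ
  obtain ⟨a, ha⟩ := hext.exists_C_mul_pow_eq_zero hγ hqγ
  have hextq : PolyVal.Extends ν₀ νq := hext.of_forall_eq_truncation hq hνq
  refine ⟨hextq, PolyVal.isKrull_of_forall_eq_truncation hq hqtop hνq,
    PolyVal.transcendental_residueRatFunc_of_comp_le hextq _ (g := C a * q ^ e) ?_ fun P i => ?_⟩
  · rw [hνq, PolyVal.truncation_mul_pow hq (PolyVal.degree_C_lt_of_natDegree_pos hq a), ha]
  · calc νq (P.comp (C a * q ^ e))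
        ≤ ν (C (P.coeff i) * (C a * q ^ e) ^ i) :=
          hνq _ ▸ PolyVal.truncation_comp_C_mul_pow_le hq he a P i
      _ = ν₀ (P.coeff i) := by
          rw [ν.map_mul, ν.map_pow, ha, smul_zero, add_zero, hext]

theorem mainTheorem10 {K : Type*} [Field K]
    {Γ : Type*} [AddCommGroup Γ] [LinearOrder Γ] [IsOrderedAddMonoid Γ]
    (ν₀ : AddValuation K (WithTop Γ)) (ν : AddValuation K[X] (WithTop Γ))
    (hν : PolyVal.IsValuationAlgebraic ν₀ ν)
    (q : K[X]) (hq : 0 < q.natDegree)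
    (νq : AddValuation K[X] (WithTop Γ))
    (hνq : ∀ f : K[X], νq f = PolyVal.truncation ν q f) :
    PolyVal.IsResidueTranscendental ν₀ νq := by
  obtain ⟨e, he, γ, hγ, hqγ⟩ := hν.exists_nsmul_mem_valueGroup (ne_zero_of_natDegree_gt hq)
  exact mainTheorem10_general hν.1 hq he hγ hqγ hνq
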